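/- Let $X$ be a (real or complex) Banach space with a $1$-unconditional basis $(x_i)_{i\ge1}$, i.e. a Schauder basis such that $\|\sum_i \varepsilon_i a_i x_i\| = \|\sum_i a_i x_i\|$ for all finitely supported scalar sequences $(a_i)$ and all signs $\varepsilon_i\in\{-1,1\}$. For $1\le p<\infty$ let $\ell_p$ be the usual space of scalar sequences, and for $p=\infty$ let $\ell_\infty$ denote the space $c_0$ of scalar sequences tending to zero, with the supremum norm. For normed spaces $F,E$ let $d(F,E)=\inf\|T\|\,\|T^{-1}\|$, the infimum being over all isomorphisms $T:F\to E$ ($d(F,E)=\infty$ if there is none). Write $[x_i]_{i\in I}$ for the closed linear span of $\{x_i : i\in I\}$; the support of a vector $\sum_i a_i x_i$ is $\{i : a_i\neq 0\}$. Suppose there exist $\delta\ge 1$ and $1\le p\le\infty$ such that (i) for each $n\in\mathbb N$ there is $m\in\mathbb N$ such that if $F\subseteq [x_i]_{i=m}^\infty$ is a subspace spanned by $n$ non-zero vectors with pairwise disjoint supports, then $\inf\{d(F,E) : E \text{ is a subspace of } \ell_p\}\le\delta$; (ii) $\inf\{d([x_i]_{i=1}^n,E) : E \text{ is a subspace of }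 \ell_p\}\to\infty$ as $n\to\infty$. Then $\mathcal A(X)$ is not amenable. Here $\mathcal A(X)$ is the Banach algebra of approximable operators on $X$, i.e. the operator-norm closure of the continuous finite-rank operators in the algebra $\mathcal B(X)$ of all bounded linear operators on $X$, and a Banach algebra $\mathcal A$ is amenable if for every Banach $\mathcal A$-bimodule $E$ every continuous derivation $D:\mathcal A\to E^*$ is inner, that is, of the form $a\mapsto a\cdot f-f\cdot a$ for some $f\in E^*$, where $(a\cdot f)(x)=f(x\cdot a)$ and $(f\cdot a)(x)=f(a\cdot x)$. -/

import Mathlib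

open Filter Topology
open scoped ENNReal

universe u v

noncomputable section

/-! ### Amenability of Banach algebras -/

/-- A Banach bimodule structure on `E` over the (not necessarily unital) normed algebra `A`:
bounded bilinear left and right actions `a · x = lact a x` and `x · a = ract a x`,
each associative and commuting with each other. -/
structure BanachBimodule (𝕜 : Type*) (A : Type*) (E : Type*) [RCLike 𝕜]
    [NonUnitalNormedRing A] [NormedSpace 𝕜 A] [NormedAddCommGroup E] [NormedSpace 𝕜 E] where
  lact : A →L[𝕜] E →L[𝕜] E
  ract : A →L[𝕜] E →L[𝕜] E
  lact_mul : ∀ (a b : A) (x : E), lact (a * b) x = lact a (lact b x)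
  ract_mul : ∀ (a b : A) (x : E), ract (a * b) x = ract b (ract a x)
  lact_ract : ∀ (a b : A) (x : E), lact a (ract b x) = ract b (lact a x)

namespace BanachBimodule

variable {𝕜 : Type*} {A : Type*} {E : Type*} [RCLike 𝕜]
  [NonUnitalNormedRing A] [NormedSpace 𝕜 A] [NormedAddCommGroup E] [NormedSpace 𝕜 E]

/-- The left action on the dual, `(a · f)(x) = f(x · a)`. -/
def dualLact (M : BanachBimodule 𝕜 A E) (a : A) (f : StrongDual 𝕜 E) : StrongDual 𝕜 E :=
  f.comp (M.ract a)

/-- The right action on the dual, `(f · a)(x) = f(a · x)`. -/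
def dualRact (M : BanachBimodule 𝕜 A E) (a : A) (f : StrongDual 𝕜 E) : StrongDual 𝕜 E :=
  f.comp (M.lact a)

/-- `D : A → E*` satisfies the Leibniz rule `D(ab) = D(a) · b + a · D(b)`. -/
def IsDualDerivation (M : BanachBimodule 𝕜 A E) (D : A →L[𝕜] StrongDual 𝕜 E) : Prop :=
  ∀ a b : A, D (a * b) = M.dualRact b (D a) + M.dualLact a (D b)

/-- `D : A → E*` is inner: `D(a) = a · f - f · a` for a fixed `f ∈ E*`. -/
def IsDualInner (M : BanachBimodule 𝕜 A E) (D : A →L[𝕜] StrongDual 𝕜 E) : Prop :=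
  ∃ f : StrongDual 𝕜 E, ∀ a : A, D a = M.dualLact a f - M.dualRact a f

end BanachBimodule

/-- The Banach algebra `A` is amenable: for every Banach `A`-bimodule `E`, every continuous
derivation `A → E*` is inner. -/
def IsAmenable (𝕜 : Type v) (A : Type u) [RCLike 𝕜]
    [NonUnitalNormedRing A] [NormedSpace 𝕜 A] [IsScalarTower 𝕜 A A] [SMulCommClass 𝕜 A A]
    [CompleteSpace A] : Prop :=
  ∀ (E : Type (max u v)) [NormedAddCommGroup E] [NormedSpace 𝕜 E] [CompleteSpace E]
    (M : BanachBimodule 𝕜 A E) (D : A →L[𝕜] StrongDual 𝕜 E),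
    M.IsDualDerivation D → M.IsDualInner D

/-! ### Approximable operators -/

/-- The algebra of continuous finite-rank operators on `X`. -/
def finiteRankOperators (𝕜 : Type*) (X : Type*) [RCLike 𝕜] [NormedAddCommGroup X]
    [NormedSpace 𝕜 X] : NonUnitalSubalgebra 𝕜 (X →L[𝕜] X) where
  carrier := {T | FiniteDimensional 𝕜 (LinearMap.range T.toLinearMap)}
  zero_mem' := by
    change FiniteDimensional 𝕜 (LinearMap.range (0 : X →ₗ[𝕜] X))
    rw [LinearMap.range_zero]
    infer_instance
  add_mem' := by
    intro S T hS hT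
    have hS' : FiniteDimensional 𝕜 (LinearMap.range S.toLinearMap) := hS
    have hT' : FiniteDimensional 𝕜 (LinearMap.range T.toLinearMap) := hT
    exact Submodule.finiteDimensional_of_le (LinearMap.range_add_le S.toLinearMap T.toLinearMap)
  mul_mem' := by
    intro S T hS _
    have hS' : FiniteDimensional 𝕜 (LinearMap.range S.toLinearMap) := hS
    exact Submodule.finiteDimensional_of_le
      (LinearMap.range_comp_le_range T.toLinearMap S.toLinearMap)
  smul_mem' := by
    intro c T hT
    have hT' : FiniteDimensional 𝕜 (LinearMap.range T.toLinearMap) := hT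
    refine Submodule.finiteDimensional_of_le (S₂ := LinearMap.range T.toLinearMap) ?_
    rintro _ ⟨x, rfl⟩
    exact ⟨c • x, by simp⟩

/-- The Banach algebra of approximable operators on `X`: the operator-norm closure of the
finite-rank operators. -/
def approximableOperators (𝕜 : Type*) (X : Type*) [RCLike 𝕜] [NormedAddCommGroup X]
    [NormedSpace 𝕜 X] : NonUnitalSubalgebra 𝕜 (X →L[𝕜] X) :=
  (finiteRankOperators 𝕜 X).topologicalClosure

instance approximableOperators.instNormedSpace (𝕜 : Type*) (X : Type*) [RCLike 𝕜]
    [NormedAddCommGroup X] [NormedSpace 𝕜 X] : NormedSpace 𝕜 (approximableOperators 𝕜 X) where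
  norm_smul_le c T := norm_smul_le c (T : X →L[𝕜] X)

instance approximableOperators.instCompleteSpace (𝕜 : Type*) (X : Type*) [RCLike 𝕜]
    [NormedAddCommGroup X] [NormedSpace 𝕜 X] [CompleteSpace X] :
    CompleteSpace (approximableOperators 𝕜 X) :=
  (finiteRankOperators 𝕜 X).isClosed_topologicalClosure.completeSpace_coe

/-! ### Banach–Mazur distance and subspaces of `ℓ_p` -/

/-- The Banach–Mazur distance `d(F, E) = inf ‖T‖ ‖T⁻¹‖` over all isomorphisms `T : F → E`
(equal to `∞` if there are none). -/
def banachMazurDist (𝕜 : Type*) (F : Type*) (E : Type*) [RCLike 𝕜]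
    [NormedAddCommGroup F] [NormedSpace 𝕜 F] [NormedAddCommGroup E] [NormedSpace 𝕜 E] : ℝ≥0∞ :=
  ⨅ T : F ≃L[𝕜] E, ‖(T : F →L[𝕜] E)‖ₑ * ‖(T.symm : E →L[𝕜] F)‖ₑ

/-- The space `ℓ_p` for `1 ≤ p < ∞`, and `c₀` for `p = ∞`, as a subspace of Mathlib's `lp`
(in which `p = ∞` gives all bounded sequences). -/
def ellP (𝕜 : Type*) [RCLike 𝕜] (p : ℝ≥0∞) : Submodule 𝕜 (lp (fun _ : ℕ => 𝕜) p) where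
  carrier := {f | p = ∞ → Tendsto (fun i => f i) atTop (𝓝 0)}
  zero_mem' := fun _ => by simp
  add_mem' := fun hf hg hp => by simpa using (hf hp).add (hg hp)
  smul_mem' := fun c _ hf hp => by simpa using (hf hp).const_smul c

/-- `inf {d(F, E) : E is a subspace of ℓ_p}`, with `c₀` in place of `ℓ_p` for `p = ∞`. -/
def distToSubspacesEllP (𝕜 : Type*) [RCLike 𝕜] (p : ℝ≥0∞) [Fact (1 ≤ p)] (F : Type*)
    [NormedAddCommGroup F] [NormedSpace 𝕜 F] : ℝ≥0∞ :=
  ⨅ (E : Submodule 𝕜 (lp (fun _ : ℕ => 𝕜) p)) (_ : E ≤ ellP 𝕜 p), banachMazurDist 𝕜 F E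

/-! ### Unconditional bases -/

namespace SchauderBasis

variable {𝕜 : Type*} {X : Type*} [RCLike 𝕜] [NormedAddCommGroup X] [NormedSpace 𝕜 X]

/-- The basis `b` is 1-unconditional: changing the signs of the coefficients does not change the
norm of a finite linear combination of basis vectors. -/
def IsOneUnconditional (b : SchauderBasis 𝕜 X) : Prop :=
  ∀ (s : Finset ℕ) (a ε : ℕ → 𝕜), (∀ i, ε i = 1 ∨ ε i = -1) →
    ‖∑ i ∈ s, (ε i * a i) • b i‖ = ‖∑ i ∈ s, a i • b i‖

/-- The support of a vector with respect to the basis `b`. -/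
def supp (b : SchauderBasis 𝕜 X) (x : X) : Set ℕ := {i | b.coord i x ≠ 0}

/-- The initial segment: the span of the first `n` basis vectors. -/
def initialSegment (b : SchauderBasis 𝕜 X) (n : ℕ) : Submodule 𝕜 X :=
  Submodule.span 𝕜 (b '' {i | i < n})

/-- The tail: the closed span of the basis vectors of index at least `m`. -/
def tail (b : SchauderBasis 𝕜 X) (m : ℕ) : Submodule 𝕜 X :=
  (Submodule.span 𝕜 (b '' {i | m ≤ i})).topologicalClosure

end SchauderBasis

end

/-! Amenability yields a virtual diagonal `M`, heuristically a limit of bounded tensors `∑ S ⊗ T`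
commuting with the approximable operators and with `∑ S T = 1`
(`IsAmenable.exists_virtual_diagonal`). For any fixed operator `R`, the "operator" `∑ S R T`
commutes with all rank-one operators, so it is a scalar. The scalar is 1 for `R = 1`. It is 0 for `R
= b.proj m`: the trace of its compression to the first `n` basis vectors is `n` times the scalar,
yet by cyclicity of the trace it is bounded independently of `n`. Hence `R = 1 - b.proj m` also
gives 1: the identity factors, on average, through arbitrarily remote tails.

Hahn-Banach turns this into an inequality `‖x‖ ≤ K ∑ c i ‖T i x‖` on each initial segment, with
contractions `T i` into any prescribed tail and `K` independent of the segment and the tail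
(`IsAmenable.exists_average_through_tail`).

On the other side, the images under `T i` of the first `n` basis vectors are, up to a small error,
combinations of a number of disjoint blocks that depends only on `n` and the error
(`exists_disjoint_approximation`). Far enough out, hypothesis (i) embeds the span of those blocks in
`ℓ_p` with constant about `δ`. The resulting maps are assembled, with weights `c i ^ (1/p)`, into
one map into an `ℓ_p`-sum of copies of `ℓ_p`, which is again `ℓ_p`; Jensen's inequality shows that
it dominates the average (`exists_lp_map_of_convex_combination`). So all initial segments embed in
`ℓ_p` with a uniform constant, against (ii). -/

/-! ### Bilinear forms on an algebra and virtual diagonals -/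

/-- The Banach space of bounded bilinear forms on `B`. -/
abbrev BoundedBilin (𝕜 : Type*) (B : Type*) [RCLike 𝕜] [NormedRing B] [NormedAlgebra 𝕜 B] :=
  B →L[𝕜] B →L[𝕜] 𝕜

namespace BoundedBilin

section Defs

variable {𝕜 : Type*} {B : Type*} [RCLike 𝕜] [NormedRing B] [NormedAlgebra 𝕜 B]

noncomputable instance instNormedAddCommGroup : NormedAddCommGroup (BoundedBilin 𝕜 B) :=
  inferInstance

noncomputable instance instNormedSpace : NormedSpace 𝕜 (BoundedBilin 𝕜 B) := inferInstance

/-- The bilinear form `(S, T) ↦ Φ (c * S) T`, as a bounded bilinear function of `c` and `Φ`. -/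
noncomputable def mulLeft : B →L[𝕜] BoundedBilin 𝕜 B →L[𝕜] BoundedBilin 𝕜 B :=
  (ContinuousLinearMap.compL 𝕜 B B (B →L[𝕜] 𝕜)).flip.comp (ContinuousLinearMap.mul 𝕜 B)

@[simp]
lemma mulLeft_apply (c : B) (Φ : BoundedBilin 𝕜 B) (S T : B) :
    mulLeft c Φ S T = Φ (c * S) T := rfl

/-- The bilinear form `(S, T) ↦ Φ S (T * c)`, as a bounded bilinear function of `c` and `Φ`. -/
noncomputable def mulRight : B →L[𝕜] BoundedBilin 𝕜 B →L[𝕜] BoundedBilin 𝕜 B :=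
  (ContinuousLinearMap.compL 𝕜 B (B →L[𝕜] 𝕜) (B →L[𝕜] 𝕜)).comp
    ((ContinuousLinearMap.compL 𝕜 B B 𝕜).flip.comp (ContinuousLinearMap.mul 𝕜 B).flip)

@[simp]
lemma mulRight_apply (c : B) (Φ : BoundedBilin 𝕜 B) (S T : B) :
    mulRight c Φ S T = Φ S (T * c) := rfl

/-- The bilinear form `(S, T) ↦ f (S * T)` attached to a functional `f`. -/
noncomputable def ofDual : (B →L[𝕜] 𝕜) →L[𝕜] BoundedBilin 𝕜 B :=
  ((ContinuousLinearMap.compL 𝕜 B (B →L[𝕜] B) (B →L[𝕜] 𝕜)).flip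
    (ContinuousLinearMap.mul 𝕜 B)).comp (ContinuousLinearMap.compL 𝕜 B B 𝕜)

@[simp]
lemma ofDual_apply (f : B →L[𝕜] 𝕜) (S T : B) : ofDual f S T = f (S * T) := rfl

/-- The bilinear form `(S, T) ↦ Φ (S * T) c`, as a bounded bilinear function of `c` and `Φ`. -/
noncomputable def mulPair : B →L[𝕜] BoundedBilin 𝕜 B →L[𝕜] BoundedBilin 𝕜 B :=
  (ContinuousLinearMap.compL 𝕜 (BoundedBilin 𝕜 B) (B →L[𝕜] 𝕜) (BoundedBilin 𝕜 B) ofDual).comp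
    (ContinuousLinearMap.flip ((ContinuousLinearMap.flipₗᵢ 𝕜 B B 𝕜).toContinuousLinearEquiv :
      BoundedBilin 𝕜 B →L[𝕜] B →L[𝕜] B →L[𝕜] 𝕜))

@[simp]
lemma mulPair_apply (c : B) (Φ : BoundedBilin 𝕜 B) (S T : B) :
    mulPair c Φ S T = Φ (S * T) c := rfl

end Defs

end BoundedBilin

/-! ### From amenability to a virtual diagonal. -/

section VirtualDiagonal

open BoundedBilin

variable {𝕜 : Type v} {X : Type u} [RCLike 𝕜] [NormedAddCommGroup X] [NormedSpace 𝕜 X]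

/-- The inclusion of the approximable operators into the bounded operators. -/
noncomputable def approximableOperators.incl :
    approximableOperators 𝕜 X →L[𝕜] (X →L[𝕜] X) where
  toFun a := a
  map_add' _ _ := rfl
  map_smul' _ _ := rfl
  cont := continuous_subtype_val

/-- The bimodule of bounded bilinear forms on the bounded operators, over the approximable
operators, with `(Φ · a)(S, T) = Φ(aS, T)` and `(a · Φ)(S, T) = Φ(S, Ta) - Φ(ST, a)`. -/
noncomputable def bilinBimodule :
    BanachBimodule 𝕜 (approximableOperators 𝕜 X) (BoundedBilin 𝕜 (X →L[𝕜] X)) where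
  lact := (mulRight - mulPair : (X →L[𝕜] X) →L[𝕜] BoundedBilin 𝕜 (X →L[𝕜] X) →L[𝕜]
    BoundedBilin 𝕜 (X →L[𝕜] X)).comp approximableOperators.incl
  ract := mulLeft.comp approximableOperators.incl
  lact_mul a b Φ := by
    ext1 S; ext1 T
    change Φ S (T * (a * b : X →L[𝕜] X)) - Φ (S * T) (a * b : X →L[𝕜] X) =
      (Φ S (T * a * b) - Φ (S * (T * a)) b) - (Φ (S * T) (a * b) - Φ (S * T * a) b)
    simp only [mul_assoc]
    abel
  ract_mul a b Φ := by
    ext1 S; ext1 T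
    change Φ ((a * b : X →L[𝕜] X) * S) T = Φ (a * (b * S)) T
    rw [mul_assoc]
  lact_ract a b Φ := by
    ext1 S; ext1 T
    change Φ (b * S) (T * a) - Φ (b * (S * T)) a = Φ (b * S) (T * a) - Φ (b * S * T) a
    rw [mul_assoc]

/-- The bounded map `a ↦ (Φ ↦ -Φ 1 a)`. -/
noncomputable def bilinDerivation :
    approximableOperators 𝕜 X →L[𝕜] StrongDual 𝕜 (BoundedBilin 𝕜 (X →L[𝕜] X)) :=
  -((ContinuousLinearMap.apply 𝕜 (StrongDual 𝕜 (X →L[𝕜] X)) (1 : X →L[𝕜] X)).flip.comp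
    approximableOperators.incl)

/-- Read `S ⊗ T` as the noncommutative one-form `S dT`, that is, `S ⊗ T - S T ⊗ 1` up to sign. The
twisted term in the bimodule is the rule `(S dT) a = S d(T a) - S T da`, and the map in question is
pairing with `-da`. Innerness then corrects `1 ⊗ 1` to a diagonal. -/
lemma isDualDerivation_bilinDerivation :
    bilinBimodule.IsDualDerivation (bilinDerivation (𝕜 := 𝕜) (X := X)) := by
  intro a b
  ext1 Φ
  change -Φ 1 (a * b : X →L[𝕜] X) =
    -(Φ 1 (a * b : X →L[𝕜] X) - Φ (1 * a : X →L[𝕜] X) b) + -Φ (a * 1 : X →L[𝕜] X) b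
  rw [one_mul, mul_one]
  abel

/-- The functional `Φ ↦ Φ 1 1 - f (Φ - Ψ)`, with `Ψ (S, T) = Φ (S * T) 1`. -/
noncomputable def virtualDiagonalOfDual (f : StrongDual 𝕜 (BoundedBilin 𝕜 (X →L[𝕜] X))) :
    BoundedBilin 𝕜 (X →L[𝕜] X) →L[𝕜] 𝕜 :=
  (ContinuousLinearMap.apply 𝕜 𝕜 (1 : X →L[𝕜] X)).comp
    (ContinuousLinearMap.apply 𝕜 (StrongDual 𝕜 (X →L[𝕜] X)) (1 : X →L[𝕜] X)) -
      (f - f.comp (mulPair 1))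

lemma virtualDiagonalOfDual_apply (f : StrongDual 𝕜 (BoundedBilin 𝕜 (X →L[𝕜] X)))
    (Φ : BoundedBilin 𝕜 (X →L[𝕜] X)) :
    virtualDiagonalOfDual f Φ = Φ 1 1 - (f Φ - f (mulPair 1 Φ)) := rfl

lemma virtualDiagonalOfDual_mulLeft (f : StrongDual 𝕜 (BoundedBilin 𝕜 (X →L[𝕜] X)))
    (a : X →L[𝕜] X) (Φ : BoundedBilin 𝕜 (X →L[𝕜] X)) :
    virtualDiagonalOfDual f (mulLeft a Φ) =
      Φ a 1 - (f (mulLeft a Φ) - f (mulLeft a (mulPair 1 Φ))) := by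
  have e : mulPair 1 (mulLeft a Φ) = mulLeft a (mulPair 1 Φ) := by
    ext1 S; ext1 T; simp only [mulPair_apply, mulLeft_apply, mul_assoc]
  have h := virtualDiagonalOfDual_apply f (mulLeft a Φ)
  rwa [e, mulLeft_apply, mul_one] at h

lemma virtualDiagonalOfDual_mulRight (f : StrongDual 𝕜 (BoundedBilin 𝕜 (X →L[𝕜] X)))
    (a : X →L[𝕜] X) (Φ : BoundedBilin 𝕜 (X →L[𝕜] X)) :
    virtualDiagonalOfDual f (mulRight a Φ) =
      Φ 1 a - (f (mulRight a Φ) - f (mulPair a Φ)) := by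
  have e : mulPair 1 (mulRight a Φ) = mulPair a Φ := by
    ext1 S; ext1 T; simp only [mulPair_apply, mulRight_apply, one_mul]
  have h := virtualDiagonalOfDual_apply f (mulRight a Φ)
  rwa [e, mulRight_apply, one_mul] at h

lemma virtualDiagonalOfDual_ofDual (f : StrongDual 𝕜 (BoundedBilin 𝕜 (X →L[𝕜] X)))
    (g : (X →L[𝕜] X) →L[𝕜] 𝕜) : virtualDiagonalOfDual f (ofDual g) = g 1 := by
  have e : mulPair 1 (ofDual g) = ofDual g := by
    ext1 S; ext1 T; simp only [mulPair_apply, ofDual_apply, mul_one]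
  have h := virtualDiagonalOfDual_apply f (ofDual g)
  rw [e, ofDual_apply, mul_one] at h
  exact h.trans ((congrArg (g 1 - ·) (sub_self _)).trans (sub_zero _))

set_option maxHeartbeats 1000000 in
/-- If the algebra of approximable operators is amenable, there is a bounded functional on the
bilinear forms on `X →L[𝕜] X` which commutes with the approximable operators and is normalised
like a virtual diagonal. -/
theorem IsAmenable.exists_virtual_diagonal [CompleteSpace X]
    (h : IsAmenable 𝕜 (approximableOperators 𝕜 X)) :
    ∃ M : BoundedBilin 𝕜 (X →L[𝕜] X) →L[𝕜] 𝕜,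
      (∀ a ∈ approximableOperators 𝕜 X, ∀ Φ, M (mulLeft a Φ) = M (mulRight a Φ)) ∧
      ∀ f, M (ofDual f) = f 1 := by
  obtain ⟨f, hf⟩ := h _ bilinBimodule bilinDerivation isDualDerivation_bilinDerivation
  have hf' : ∀ a ∈ approximableOperators 𝕜 X, ∀ Φ : BoundedBilin 𝕜 (X →L[𝕜] X),
      -Φ 1 a = f (mulLeft a Φ) - (f (mulRight a Φ) - f (mulPair a Φ)) := by
    intro a ha Φ
    rw [← ContinuousLinearMap.map_sub f]
    exact DFunLike.congr_fun (hf ⟨a, ha⟩) Φ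
  have aux : ∀ α β p q r s t t' : 𝕜, -β = p - (q - r) → -α = s - (t - t') → t' = t →
      α - (p - s) = β - (q - r) := by
    intro α β p q r s t t' h1 h2 h3
    linear_combination h1 - h2 - h3
  refine ⟨virtualDiagonalOfDual f, fun a ha Φ => ?_, virtualDiagonalOfDual_ofDual f⟩
  have e1 : mulPair a (mulPair 1 Φ) = mulRight a (mulPair 1 Φ) := by
    ext1 S; ext1 T; simp only [mulPair_apply, mulRight_apply, mul_assoc]
  -- For `Ψ = mulPair 1 Φ` the two subtracted terms cancel, leaving `f (mulLeft a Ψ) = -Φ a 1`. Both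
  -- sides of the goal then equal `-f (mulLeft a Φ)`.
  have h2 := hf' a ha (mulPair 1 Φ)
  rw [mulPair_apply, one_mul] at h2
  rw [virtualDiagonalOfDual_mulLeft, virtualDiagonalOfDual_mulRight]
  exact aux _ _ _ _ _ _ _ _ (hf' a ha Φ) h2 (congrArg f e1)

end VirtualDiagonal

/-! ### One-unconditional bases -/

namespace SchauderBasis

variable {𝕜 : Type*} {X : Type*} [RCLike 𝕜] [NormedAddCommGroup X] [NormedSpace 𝕜 X]
  {b : SchauderBasis 𝕜 X}

lemma coord_sum (b : SchauderBasis 𝕜 X) (s : Finset ℕ) (a : ℕ → 𝕜) (i : ℕ) :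
    b.coord i (∑ j ∈ s, a j • b j) = if i ∈ s then a i else 0 := by
  simp [b.ortho, Pi.single_apply]

lemma coord_self (b : SchauderBasis 𝕜 X) (i : ℕ) : b.coord i (b i) = 1 := by
  simp [b.ortho]

lemma coord_of_ne (b : SchauderBasis 𝕜 X) {i j : ℕ} (h : i ≠ j) : b.coord i (b j) = 0 := by
  simp [b.ortho, h]

lemma mem_tail_iff (b : SchauderBasis 𝕜 X) (m : ℕ) (x : X) :
    x ∈ tail b m ↔ ∀ i < m, b.coord i x = 0 := by
  constructor
  · intro hx i hi
    have hclosed : IsClosed {x : X | b.coord i x = 0} :=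
      isClosed_eq (b.coord i).continuous continuous_const
    refine closure_minimal (t := {x : X | b.coord i x = 0}) ?_ hclosed hx
    intro y hy
    have : Submodule.span 𝕜 (b '' {i | m ≤ i}) ≤ LinearMap.ker (b.coord i).toLinearMap := by
      rw [Submodule.span_le]
      rintro _ ⟨j, hj, rfl⟩
      have hij : i ≠ j := (hi.trans_le hj).ne
      simp [b.ortho, hij]
    exact this hy
  · intro h
    refine mem_closure_of_tendsto (tendsto_proj b x) (Eventually.of_forall fun n => ?_)
    rw [proj_apply]
    refine Submodule.sum_mem _ fun i _ => ?_
    by_cases hi : i < m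
    · rw [h i hi, zero_smul]
      exact Submodule.zero_mem _
    · exact Submodule.smul_mem _ _ (Submodule.subset_span ⟨i, not_lt.mp hi, rfl⟩)

lemma tail_antitone (b : SchauderBasis 𝕜 X) : Antitone (tail b) := by
  intro m n hmn x hx
  rw [mem_tail_iff] at hx ⊢
  exact fun i hi => hx i (hi.trans_le hmn)

/-- A number in `[-1, 1]` is a convex combination of `1` and `-1`. Induction on the set `t` of
indices where the multiplier need not be a sign replaces one such entry at a time. -/
lemma IsOneUnconditional.norm_sum_real_mul_le_of_finset (hb : IsOneUnconditional b)
    (s : Finset ℕ) (a : ℕ → 𝕜) (t : Finset ℕ) :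
    ∀ θ : ℕ → ℝ, (∀ i ∈ t, |θ i| ≤ 1) → (∀ i ∉ t, θ i = 1 ∨ θ i = -1) →
      ‖∑ i ∈ s, ((θ i : 𝕜) * a i) • b i‖ ≤ ‖∑ i ∈ s, a i • b i‖ := by
  induction t using Finset.induction_on with
  | empty =>
    intro θ _ h
    refine (hb s a (fun i => (θ i : 𝕜)) fun i => ?_).le
    rcases h i (Finset.notMem_empty i) with h | h <;> simp [h]
  | insert j t hj ih =>
    intro θ h1 h2
    have hθj := abs_le.mp (h1 j (Finset.mem_insert_self j t))
    have key : ∀ e : ℝ, (e = 1 ∨ e = -1) →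
        ‖∑ i ∈ s, ((Function.update θ j e i : ℝ) * a i : 𝕜) • b i‖ ≤ ‖∑ i ∈ s, a i • b i‖ := by
      intro e he
      refine ih _ (fun i hi => ?_) fun i hi => ?_
      · have hij : i ≠ j := fun h => hj (h ▸ hi)
        rw [Function.update_of_ne hij]
        exact h1 i (Finset.mem_insert_of_mem hi)
      · by_cases hij : i = j
        · subst hij
          simpa using he
        · rw [Function.update_of_ne hij]
          exact h2 i (by simp [hij, hi])
    have hdecomp : ∑ i ∈ s, ((θ i : 𝕜) * a i) • b i =
        (((1 + θ j) / 2 : ℝ) : 𝕜) • ∑ i ∈ s, ((Function.update θ j 1 i : ℝ) * a i : 𝕜) • b i +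
        (((1 - θ j) / 2 : ℝ) : 𝕜) •
          ∑ i ∈ s, ((Function.update θ j (-1) i : ℝ) * a i : 𝕜) • b i := by
      rw [Finset.smul_sum, Finset.smul_sum, ← Finset.sum_add_distrib]
      refine Finset.sum_congr rfl fun i _ => ?_
      rw [smul_smul, smul_smul, ← add_smul, ← mul_assoc, ← mul_assoc, ← add_mul]
      congr 2
      rw [← RCLike.ofReal_mul, ← RCLike.ofReal_mul, ← RCLike.ofReal_add]
      congr 1
      by_cases hij : i = j
      · subst hij
        simp only [Function.update_self]
        ring
      · rw [Function.update_of_ne hij, Function.update_of_ne hij]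
        ring
    rw [hdecomp]
    refine (norm_add_le _ _).trans ?_
    rw [norm_smul, norm_smul, RCLike.norm_ofReal, RCLike.norm_ofReal,
      abs_of_nonneg (by linarith), abs_of_nonneg (by linarith)]
    have k1 := mul_le_mul_of_nonneg_left (key 1 (Or.inl rfl))
      (show (0 : ℝ) ≤ (1 + θ j) / 2 by linarith)
    have k2 := mul_le_mul_of_nonneg_left (key (-1) (Or.inr rfl))
      (show (0 : ℝ) ≤ (1 - θ j) / 2 by linarith)
    linarith

/-- Real multipliers bounded by `c` have norm at most `c` on a one-unconditional basis. -/
lemma IsOneUnconditional.norm_sum_real_mul_le (hb : IsOneUnconditional b)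
    (s : Finset ℕ) (a : ℕ → 𝕜) (θ : ℕ → ℝ) {c : ℝ} (hc : 0 < c) (hθ : ∀ i ∈ s, |θ i| ≤ c) :
    ‖∑ i ∈ s, ((θ i : 𝕜) * a i) • b i‖ ≤ c * ‖∑ i ∈ s, a i • b i‖ := by
  have h := hb.norm_sum_real_mul_le_of_finset s a s
    (fun i => if i ∈ s then θ i / c else 1)
    (fun i hi => by
      simp only [hi, if_true]
      rw [abs_div, abs_of_pos hc, div_le_one hc]
      exact hθ i hi)
    (fun i hi => by simp [hi])
  have e : ∑ i ∈ s, ((θ i : 𝕜) * a i) • b i =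
      (c : 𝕜) • ∑ i ∈ s, (((if i ∈ s then θ i / c else 1 : ℝ) : 𝕜) * a i) • b i := by
    rw [Finset.smul_sum]
    refine Finset.sum_congr rfl fun i hi => ?_
    rw [smul_smul, ← mul_assoc, ← RCLike.ofReal_mul, if_pos hi, mul_div_cancel₀ _ hc.ne']
  rw [e, norm_smul, RCLike.norm_ofReal, abs_of_pos hc]
  gcongr

/-- Scalar multipliers bounded by `c` have norm at most `2 * c` on a one-unconditional basis. -/
lemma IsOneUnconditional.norm_sum_mul_le (hb : IsOneUnconditional b)
    (s : Finset ℕ) (a z : ℕ → 𝕜) {c : ℝ} (hc : 0 < c) (hz : ∀ i ∈ s, ‖z i‖ ≤ c) :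
    ‖∑ i ∈ s, (z i * a i) • b i‖ ≤ 2 * c * ‖∑ i ∈ s, a i • b i‖ := by
  have h1 := hb.norm_sum_real_mul_le s a (fun i => RCLike.re (z i)) hc
    fun i hi => (RCLike.abs_re_le_norm _).trans (hz i hi)
  have h2 := hb.norm_sum_real_mul_le s a (fun i => RCLike.im (z i)) hc
    fun i hi => (RCLike.abs_im_le_norm _).trans (hz i hi)
  have e : ∑ i ∈ s, (z i * a i) • b i = ∑ i ∈ s, ((RCLike.re (z i) : 𝕜) * a i) • b i +
      (RCLike.I : 𝕜) • ∑ i ∈ s, ((RCLike.im (z i) : 𝕜) * a i) • b i := by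
    rw [Finset.smul_sum, ← Finset.sum_add_distrib]
    refine Finset.sum_congr rfl fun i _ => ?_
    rw [smul_smul, ← add_smul]
    congr 1
    conv_lhs => rw [← RCLike.re_add_im (z i)]
    ring
  have hI : ‖(RCLike.I : 𝕜)‖ ≤ 1 := by
    rcases RCLike.I_eq_zero_or_im_I_eq_one (K := 𝕜) with h | h
    · simp [h]
    · exact (RCLike.norm_I_of_ne_zero (by rintro h0; simp [h0] at h)).le
  rw [e]
  refine (norm_add_le _ _).trans ?_
  rw [norm_smul]
  have h3 := mul_le_of_le_one_left (norm_nonneg (∑ i ∈ s, ((RCLike.im (z i) : 𝕜) * a i) • b i)) hI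
  linarith

lemma proj_eq_sum_range (b : SchauderBasis 𝕜 X) {n N : ℕ} (hN : n ≤ N) (x : X) :
    b.proj n x =
      ∑ i ∈ Finset.range N, (((if i < n then 1 else 0 : ℝ) : 𝕜) * b.coord i x) • b i := by
  rw [proj_apply, ← Finset.sum_subset (Finset.range_mono hN)
    (f := fun i => (((if i < n then 1 else 0 : ℝ) : 𝕜) * b.coord i x) • b i)
    (fun i _ hi => by simp [show ¬ i < n by simpa using hi])]
  exact Finset.sum_congr rfl fun i hi => by simp [Finset.mem_range.mp hi]

lemma IsOneUnconditional.norm_proj_le (hb : IsOneUnconditional b) (n : ℕ) :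
    ‖b.proj n‖ ≤ 1 := by
  refine ContinuousLinearMap.opNorm_le_bound _ zero_le_one fun x => ?_
  refine ge_of_tendsto ((tendsto_proj b x).norm.const_mul 1) ?_
  filter_upwards [eventually_ge_atTop n] with N hN
  have h := hb.norm_sum_real_mul_le (Finset.range N) (fun i => b.coord i x)
    (fun i => if i < n then 1 else 0) one_pos (fun i _ => by split_ifs <;> simp)
  rw [← proj_eq_sum_range b hN] at h
  rwa [proj_apply b N]

lemma IsOneUnconditional.norm_one_sub_proj_le (hb : IsOneUnconditional b) (n : ℕ) :
    ‖(1 : X →L[𝕜] X) - b.proj n‖ ≤ 1 := by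
  refine ContinuousLinearMap.opNorm_le_bound _ zero_le_one fun x => ?_
  refine le_of_tendsto_of_tendsto (((tendsto_proj b x).sub_const (b.proj n x)).norm)
    ((tendsto_proj b x).norm.const_mul 1) ?_
  filter_upwards [eventually_ge_atTop n] with N hN
  have h := hb.norm_sum_real_mul_le (Finset.range N) (fun i => b.coord i x)
    (fun i => if i < n then 0 else 1) one_pos (fun i _ => by split_ifs <;> simp)
  have e : b.proj N x - b.proj n x =
      ∑ i ∈ Finset.range N, (((if i < n then 0 else 1 : ℝ) : 𝕜) * b.coord i x) • b i := by
    rw [proj_eq_sum_range b hN, proj_apply, ← Finset.sum_sub_distrib]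
    exact Finset.sum_congr rfl fun i hi => by split_ifs <;> simp
  rwa [e, proj_apply b N]

lemma one_sub_proj_mem_tail (b : SchauderBasis 𝕜 X) (n : ℕ) (x : X) :
    ((1 : X →L[𝕜] X) - b.proj n) x ∈ tail b n := by
  rw [mem_tail_iff]
  intro i hi
  change b.coord i (x - b.proj n x) = 0
  rw [map_sub, proj_apply, coord_sum, if_pos (Finset.mem_range.mpr hi), sub_self]

lemma proj_eq_self_of_mem_initialSegment (b : SchauderBasis 𝕜 X) {n : ℕ} {x : X}
    (hx : x ∈ initialSegment b n) : b.proj n x = x := by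
  have : initialSegment b n ≤ LinearMap.ker (b.proj n - 1 : X →L[𝕜] X).toLinearMap := by
    refine Submodule.span_le.mpr ?_
    rintro _ ⟨i, hi, rfl⟩
    change b.proj n (b i) - b i = 0
    rw [proj_apply_basis_mem, if_pos (show i < n from hi), sub_self]
  exact sub_eq_zero.mp (this hx)

end SchauderBasis

/-! ### Matrix coefficients of a virtual diagonal -/

namespace BoundedBilin

section Sandwich

variable {𝕜 : Type*} {B : Type*} [RCLike 𝕜] [NormedRing B] [NormedAlgebra 𝕜 B]

/-- The bilinear form `(S, T) ↦ ψ (S * R * T)`. -/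
noncomputable def sandwich (R : B) (ψ : B →L[𝕜] 𝕜) : BoundedBilin 𝕜 B :=
  ContinuousLinearMap.comp (ofDual ψ) ((ContinuousLinearMap.mul 𝕜 B).flip R)

@[simp]
lemma sandwich_apply (R : B) (ψ : B →L[𝕜] 𝕜) (S T : B) : sandwich R ψ S T = ψ (S * R * T) := rfl

/-- The functional `S ↦ ψ (P * S * P)`. -/
noncomputable def compress (P : B) (ψ : B →L[𝕜] 𝕜) : B →L[𝕜] 𝕜 :=
  ψ.comp (((ContinuousLinearMap.mul 𝕜 B).flip P).comp (ContinuousLinearMap.mul 𝕜 B P))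

@[simp]
lemma compress_apply (P : B) (ψ : B →L[𝕜] 𝕜) (S : B) : compress P ψ S = ψ (P * S * P) := rfl

end Sandwich

end BoundedBilin

section VirtualDiagonal

open BoundedBilin

variable {𝕜 : Type v} {X : Type u} [RCLike 𝕜] [NormedAddCommGroup X] [NormedSpace 𝕜 X]

/-- The functional `S ↦ g (S x)`. -/
noncomputable def vectorFunctional (g : X →L[𝕜] 𝕜) (x : X) : (X →L[𝕜] X) →L[𝕜] 𝕜 :=
  g.comp (ContinuousLinearMap.apply 𝕜 X x)

@[simp]
lemma vectorFunctional_apply (g : X →L[𝕜] 𝕜) (x : X) (S : X →L[𝕜] X) :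
    vectorFunctional g x S = g (S x) := rfl

lemma smulRight_mem_approximableOperators (g : X →L[𝕜] 𝕜) (y : X) :
    g.smulRight y ∈ approximableOperators 𝕜 X := by
  refine NonUnitalSubalgebra.le_topologicalClosure _ ?_
  refine Submodule.finiteDimensional_of_le (S₂ := Submodule.span 𝕜 {y}) ?_
  rintro _ ⟨x, rfl⟩
  exact Submodule.smul_mem _ _ (Submodule.mem_span_singleton_self y)

variable {M : BoundedBilin 𝕜 (X →L[𝕜] X) →L[𝕜] 𝕜}
  (hM : ∀ a ∈ approximableOperators 𝕜 X, ∀ Φ, M (mulLeft a Φ) = M (mulRight a Φ))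

include hM in
-- Commutation of `M` with the rank-one operator `g.smulRight y`, tested on a matrix coefficient of
-- `S R T`.
lemma apply_sandwich_vectorFunctional_comm (R : X →L[𝕜] X) (f g : X →L[𝕜] 𝕜) (x y : X) :
    f y * M (sandwich R (vectorFunctional g x)) = g x * M (sandwich R (vectorFunctional f y)) := by
  have h := hM _ (smulRight_mem_approximableOperators g y) (sandwich R (vectorFunctional f x))
  have e1 : mulLeft (g.smulRight y) (sandwich R (vectorFunctional f x)) =
      f y • sandwich R (vectorFunctional g x) := by
    ext1 S; ext1 T
    change f (g (S (R (T x))) • y) = f y * g (S (R (T x)))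
    rw [map_smul, smul_eq_mul, mul_comm]
  have e2 : mulRight (g.smulRight y) (sandwich R (vectorFunctional f x)) =
      g x • sandwich R (vectorFunctional f y) := by
    ext1 S; ext1 T
    change f (S (R (T (g x • y)))) = g x * f (S (R (T y)))
    rw [map_smul, map_smul, map_smul, map_smul, smul_eq_mul]
  rw [e1, e2] at h
  exact (M.map_smul _ _).symm.trans (h.trans (M.map_smul _ _))

variable {b : SchauderBasis 𝕜 X}

include hM in
-- A Schur-type statement: in the weak sense, the average of `S R T` is a scalar multiple of the
-- identity, the scalar being its `(0, 0)` matrix coefficient.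
lemma apply_sandwich_vectorFunctional (b : SchauderBasis 𝕜 X) (R : X →L[𝕜] X)
    (g : X →L[𝕜] 𝕜) (x : X) :
    M (sandwich R (vectorFunctional g x)) =
      g x * M (sandwich R (vectorFunctional (b.coord 0) (b 0))) := by
  have h := apply_sandwich_vectorFunctional_comm hM R (b.coord 0) g x (b 0)
  rwa [SchauderBasis.coord_self, one_mul] at h

lemma compress_proj_eq_sum (n : ℕ) (ψ : (X →L[𝕜] X) →L[𝕜] 𝕜) :
    compress (b.proj n) ψ = ∑ i ∈ Finset.range n, ∑ j ∈ Finset.range n,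
      ψ ((b.coord j).smulRight (b i)) • vectorFunctional (b.coord i) (b j) := by
  ext1 S
  have h : b.proj n * S * b.proj n = ∑ i ∈ Finset.range n, ∑ j ∈ Finset.range n,
      b.coord i (S (b j)) • (b.coord j).smulRight (b i) := by
    ext1 x
    change b.proj n (S (b.proj n x)) = _
    rw [SchauderBasis.proj_apply b n x, map_sum, SchauderBasis.proj_apply, sum_apply]
    refine Finset.sum_congr rfl fun i _ => ?_
    rw [map_sum, Finset.sum_smul, sum_apply]
    refine Finset.sum_congr rfl fun j _ => ?_
    rw [map_smul, map_smul]
    change _ = b.coord i (S (b j)) • (b.coord j x • b i)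
    rw [smul_smul, smul_eq_mul, mul_comm]
  rw [compress_apply, h, map_sum, sum_apply]
  refine Finset.sum_congr rfl fun i _ => ?_
  rw [map_sum, sum_apply]
  refine Finset.sum_congr rfl fun j _ => ?_
  rw [map_smul]
  exact mul_comm _ _

lemma sandwich_sum {ι : Type*} (R : X →L[𝕜] X) (s : Finset ι)
    (ψ : ι → (X →L[𝕜] X) →L[𝕜] 𝕜) :
    sandwich R (∑ i ∈ s, ψ i) = ∑ i ∈ s, sandwich R (ψ i) := by
  ext1 S; ext1 T
  simp only [sum_apply, sandwich_apply]

lemma sandwich_smul (R : X →L[𝕜] X) (c : 𝕜) (ψ : (X →L[𝕜] X) →L[𝕜] 𝕜) :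
    sandwich R (c • ψ) = c • sandwich R ψ := rfl

include hM in
lemma apply_sandwich_compress_proj (n : ℕ) (R : X →L[𝕜] X) (ψ : (X →L[𝕜] X) →L[𝕜] 𝕜) :
    M (sandwich R (compress (b.proj n) ψ)) =
      ψ (b.proj n) * M (sandwich R (vectorFunctional (b.coord 0) (b 0))) := by
  have hP : b.proj n = ∑ i ∈ Finset.range n, (b.coord i).smulRight (b i) := rfl
  rw [compress_proj_eq_sum, sandwich_sum, map_sum, hP, map_sum, Finset.sum_mul]
  refine Finset.sum_congr rfl fun i hi => ?_
  rw [sandwich_sum, map_sum, Finset.sum_eq_single i]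
  · rw [sandwich_smul, map_smul, apply_sandwich_vectorFunctional hM b, SchauderBasis.coord_self,
      one_mul, smul_eq_mul]
  · intro j _ hji
    rw [sandwich_smul, map_smul, apply_sandwich_vectorFunctional hM b,
      SchauderBasis.coord_of_ne b hji.symm, zero_mul, smul_zero]
  · exact fun h => (h hi).elim

/-- Cyclicity of the trace: the trace of `P_n S P_m T P_n` is rewritten as a sum over the `m`
indices of `P_m`, which allows bounds uniform in `n`. -/
lemma sum_sandwich_proj_apply (m n : ℕ) (S T : X →L[𝕜] X) :
    (∑ k ∈ Finset.range n, sandwich (b.proj m) (vectorFunctional (b.coord k) (b k))) S T =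
      ∑ i ∈ Finset.range m, b.coord i (T (b.proj n (S (b i)))) := by
  rw [sum_apply, sum_apply]
  have h1 : ∀ k, sandwich (b.proj m) (vectorFunctional (b.coord k) (b k)) S T =
      ∑ i ∈ Finset.range m, b.coord i (T (b k)) * b.coord k (S (b i)) := by
    intro k
    change b.coord k (S (b.proj m (T (b k)))) = _
    rw [SchauderBasis.proj_apply, map_sum, map_sum]
    simp only [map_smul, smul_eq_mul]
  simp only [h1]
  rw [Finset.sum_comm]
  refine Finset.sum_congr rfl fun i _ => ?_
  rw [SchauderBasis.proj_apply, map_sum, map_sum]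
  simp only [map_smul, smul_eq_mul]
  exact Finset.sum_congr rfl fun k _ => mul_comm _ _

include hM in
-- All diagonal coefficients equal the same scalar `τ`, so `n` of them add up to `n * τ`, while the
-- trace identity bounds the sum uniformly in `n`.
lemma apply_sandwich_proj_vectorFunctional_eq_zero (hb : SchauderBasis.IsOneUnconditional b)
    (m : ℕ) :
    M (sandwich (b.proj m) (vectorFunctional (b.coord 0) (b 0))) = 0 := by
  set τ := M (sandwich (b.proj m) (vectorFunctional (b.coord 0) (b 0))) with hτ
  set C : ℝ := ∑ i ∈ Finset.range m, ‖b.coord i‖ * ‖b i‖ with hC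
  have hC0 : 0 ≤ C := Finset.sum_nonneg fun i _ => by positivity
  have hbound : ∀ n : ℕ, n * ‖τ‖ ≤ ‖M‖ * C := by
    intro n
    have h1 : M (∑ k ∈ Finset.range n,
        sandwich (b.proj m) (vectorFunctional (b.coord k) (b k))) = n * τ := by
      rw [map_sum]
      have : ∀ k, M (sandwich (b.proj m) (vectorFunctional (b.coord k) (b k))) = τ := by
        intro k
        rw [apply_sandwich_vectorFunctional hM b, SchauderBasis.coord_self, one_mul]
      simp [this]
    have h2 : ‖∑ k ∈ Finset.range n,
        sandwich (b.proj m) (vectorFunctional (b.coord k) (b k))‖ ≤ C := by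
      refine ContinuousLinearMap.opNorm_le_bound₂ _ hC0 fun S T => ?_
      rw [sum_sandwich_proj_apply, hC, Finset.sum_mul, Finset.sum_mul]
      refine norm_sum_le_of_le _ fun i _ => ?_
      calc ‖b.coord i (T (b.proj n (S (b i))))‖
          ≤ ‖b.coord i‖ * (‖T‖ * (‖b.proj n‖ * (‖S‖ * ‖b i‖))) := by
            refine (ContinuousLinearMap.le_opNorm _ _).trans ?_
            gcongr
            refine (ContinuousLinearMap.le_opNorm _ _).trans ?_
            gcongr
            refine (ContinuousLinearMap.le_opNorm _ _).trans ?_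
            gcongr
            exact ContinuousLinearMap.le_opNorm _ _
        _ ≤ ‖b.coord i‖ * (‖T‖ * (1 * (‖S‖ * ‖b i‖))) := by
            gcongr
            exact hb.norm_proj_le n
        _ = ‖b.coord i‖ * ‖b i‖ * ‖S‖ * ‖T‖ := by ring
    have h3 := M.le_opNorm_of_le h2
    rw [h1, norm_mul, RCLike.norm_natCast] at h3
    exact h3
  by_contra h0
  have hpos : 0 < ‖τ‖ := norm_pos_iff.mpr h0
  obtain ⟨n, hn⟩ := exists_nat_gt (‖M‖ * C / ‖τ‖)
  exact absurd (hbound n) (not_le.mpr ((div_lt_iff₀ hpos).mp hn))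

include hM in
/-- The virtual diagonal lives on the tails of the basis. -/
lemma apply_sandwich_one_sub_proj_compress (hb : SchauderBasis.IsOneUnconditional b)
    (hM1 : ∀ f, M (ofDual f) = f 1) (m n : ℕ) (ψ : (X →L[𝕜] X) →L[𝕜] 𝕜) :
    M (sandwich (1 - b.proj m) (compress (b.proj n) ψ)) = ψ (b.proj n) := by
  have h1 : sandwich (1 - b.proj m) (vectorFunctional (b.coord 0) (b 0)) =
      ofDual (vectorFunctional (b.coord 0) (b 0)) -
        sandwich (b.proj m) (vectorFunctional (b.coord 0) (b 0)) := by
    ext1 S; ext1 T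
    simp only [sub_apply, sandwich_apply, ofDual_apply, mul_sub, sub_mul, mul_one, map_sub]
  rw [apply_sandwich_compress_proj hM, h1, ContinuousLinearMap.map_sub, hM1,
    apply_sandwich_proj_vectorFunctional_eq_zero hM hb m, vectorFunctional_apply]
  change _ * (b.coord 0 (b 0) - 0) = _
  rw [SchauderBasis.coord_self, sub_zero, mul_one]

end VirtualDiagonal

/-! ### Separation -/

/-- A vector whose image under every functional is controlled by a balanced set is close to convex
combinations of elements of that set. -/
lemma exists_convex_combination_near {𝕜 : Type*} {E : Type*} [RCLike 𝕜] [NormedAddCommGroup E]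
    [NormedSpace 𝕜 E] (W : Set E) (P : E)
    (hW : ∀ w ∈ W, ∀ c : 𝕜, ‖c‖ ≤ 1 → c • w ∈ W)
    (h : ∀ (ψ : E →L[𝕜] 𝕜) (u : ℝ), (∀ w ∈ W, ‖ψ w‖ ≤ u) → ‖ψ P‖ ≤ u) {ε : ℝ} (hε : 0 < ε) :
    ∃ (ι : Type) (_ : Fintype ι) (c : ι → ℝ) (z : ι → E), (∀ i, 0 ≤ c i) ∧ ∑ i, c i = 1 ∧
      (∀ i, z i ∈ W) ∧ ‖P - ∑ i, (c i : 𝕜) • z i‖ < ε := by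
  let _ : NormedSpace ℝ E := NormedSpace.restrictScalars ℝ 𝕜 E
  have : IsScalarTower ℝ 𝕜 E := RestrictScalars.isScalarTower ℝ 𝕜 E
  have hP : P ∈ closure (convexHull ℝ W) := by
    by_contra hP
    obtain ⟨ψ, u, h1, h2⟩ := RCLike.geometric_hahn_banach_closed_point (𝕜 := 𝕜)
      (convex_convexHull ℝ W).closure isClosed_closure hP
    have h3 : ‖ψ P‖ ≤ u := by
      refine h ψ u fun w hw => ?_
      obtain ⟨c, hc, hcw⟩ : ∃ c : 𝕜, ‖c‖ ≤ 1 ∧ c * ψ w = (‖ψ w‖ : 𝕜) := by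
        by_cases h0 : ψ w = 0
        · exact ⟨1, by simp, by simp [h0]⟩
        · have hn : (‖ψ w‖ : 𝕜) ≠ 0 := by simpa using h0
          refine ⟨(starRingEnd 𝕜) (ψ w) / ‖ψ w‖, ?_, ?_⟩
          · rw [norm_div, RCLike.norm_conj, RCLike.norm_ofReal, abs_norm,
              div_self (norm_ne_zero_iff.mpr h0)]
          · rw [div_mul_eq_mul_div, RCLike.conj_mul, div_eq_iff hn, sq]
      have h4 := h1 _ (subset_closure (subset_convexHull ℝ W (hW w hw c hc)))
      rw [map_smul, smul_eq_mul, hcw, RCLike.ofReal_re] at h4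
      exact h4.le
    exact absurd ((RCLike.re_le_norm (ψ P)).trans h3) (not_le.mpr h2)
  obtain ⟨y, hy, hyP⟩ := Metric.mem_closure_iff.mp hP ε hε
  obtain ⟨ι, hι, c, z, hc, hc1, hz, rfl⟩ := mem_convexHull_iff_exists_fintype.mp hy
  refine ⟨ι, hι, c, z, hc, hc1, hz, ?_⟩
  have e : ∑ i, (c i : 𝕜) • z i = ∑ i, c i • z i :=
    Finset.sum_congr rfl fun i _ => by rw [← RCLike.algebraMap_eq_ofReal, algebraMap_smul]
  rwa [e, ← dist_eq_norm]

/-! ### Averaged factorization of initial segments through tails. -/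

section Tails

open BoundedBilin

variable {𝕜 : Type v} {X : Type u} [RCLike 𝕜] [NormedAddCommGroup X] [NormedSpace 𝕜 X]

/-- If the approximable operators on a space with a one-unconditional basis form an amenable
algebra, the initial segments of the basis factor, on average, through arbitrary tails. -/
theorem IsAmenable.exists_average_through_tail [CompleteSpace X]
    (h : IsAmenable 𝕜 (approximableOperators 𝕜 X)) {b : SchauderBasis 𝕜 X}
    (hb : SchauderBasis.IsOneUnconditional b) :
    ∃ K : ℝ, 0 < K ∧ ∀ m n : ℕ, ∃ (ι : Type) (_ : Fintype ι) (c : ι → ℝ) (T : ι → X →L[𝕜] X),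
      (∀ i, 0 ≤ c i) ∧ ∑ i, c i = 1 ∧ (∀ i, ‖T i‖ ≤ 1) ∧ (∀ i x, T i x ∈ SchauderBasis.tail b m) ∧
      ∀ x ∈ SchauderBasis.initialSegment b n, ‖x‖ ≤ K * ∑ i, c i * ‖T i x‖ := by
  obtain ⟨M, hM, hM1⟩ := h.exists_virtual_diagonal
  -- The added `1` permits division by `K` even when `‖M‖ = 0`.
  set K : ℝ := ‖M‖ + 1 with hK
  have hKpos : 0 < K := by positivity
  refine ⟨2 * K, by positivity, fun m n => ?_⟩
  set P := b.proj n
  set Q := (1 : X →L[𝕜] X) - b.proj m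
  -- The whole constant `K` is put on `S`, so that the `T i` come out as contractions.
  let W : Set (X →L[𝕜] X) := {w | ∃ S T : X →L[𝕜] X, ‖S‖ ≤ K ∧ ‖T‖ ≤ 1 ∧ P * (S * Q * T) * P = w}
  have hW : ∀ w ∈ W, ∀ c : 𝕜, ‖c‖ ≤ 1 → c • w ∈ W := by
    rintro _ ⟨S, T, hS, hT, rfl⟩ a ha
    refine ⟨S, a • T, hS, ?_, ?_⟩
    · rw [norm_smul]
      exact mul_le_one₀ ha (norm_nonneg _) hT
    · rw [mul_smul_comm, mul_smul_comm, smul_mul_assoc]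
  have hsep : ∀ (ψ : (X →L[𝕜] X) →L[𝕜] 𝕜) (u : ℝ), (∀ w ∈ W, ‖ψ w‖ ≤ u) → ‖ψ P‖ ≤ u := by
    intro ψ u hu
    have hu0 : 0 ≤ u := (norm_nonneg _).trans
      (hu _ ⟨0, 0, by simpa using hKpos.le, by simp, rfl⟩)
    have h1 : ‖sandwich Q (compress P ψ)‖ ≤ u / K := by
      refine ContinuousLinearMap.opNorm_le_bound₂ _ (by positivity) fun S T => ?_
      rw [sandwich_apply, compress_apply]
      by_cases hS : S = 0
      · simp [hS]
      by_cases hT : T = 0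
      · simp [hT]
      have hS' : 0 < ‖S‖ := norm_pos_iff.mpr hS
      have hT' : 0 < ‖T‖ := norm_pos_iff.mpr hT
      have h2 := hu _ ⟨((K / ‖S‖ : ℝ) : 𝕜) • S, ((1 / ‖T‖ : ℝ) : 𝕜) • T, ?_, ?_, rfl⟩
      · rw [smul_mul_assoc, smul_mul_assoc, mul_smul_comm, mul_smul_comm, smul_mul_assoc,
          mul_smul_comm, smul_mul_assoc, map_smul, map_smul, norm_smul, norm_smul,
          RCLike.norm_ofReal, RCLike.norm_ofReal, abs_of_pos (by positivity),
          abs_of_pos (by positivity)] at h2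
        rw [div_mul_eq_mul_div, div_mul_eq_mul_div, le_div_iff₀ hKpos]
        have h3 := mul_le_mul_of_nonneg_right h2 (mul_pos hS' hT').le
        refine le_trans (le_of_eq ?_) (h3.trans (le_of_eq (mul_assoc _ _ _).symm))
        field_simp
      · rw [norm_smul, RCLike.norm_ofReal, abs_of_pos (by positivity),
          div_mul_cancel₀ _ hS'.ne']
      · rw [norm_smul, RCLike.norm_ofReal, abs_of_pos (by positivity),
          div_mul_cancel₀ _ hT'.ne']
    have h2 := M.le_opNorm_of_le h1
    rw [apply_sandwich_one_sub_proj_compress hM hb hM1] at h2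
    refine h2.trans ?_
    rw [← mul_div_assoc, div_le_iff₀ hKpos, mul_comm]
    exact mul_le_mul_of_nonneg_left (by simp [hK]) hu0
  obtain ⟨ι, hι, c, z, hc, hc1, hz, hnear⟩ := exists_convex_combination_near (𝕜 := 𝕜) W P hW hsep
    (show (0 : ℝ) < 1 / 2 by norm_num)
  choose S T hS hT hST using hz
  refine ⟨ι, hι, c, fun i => Q * T i, hc, hc1, fun i => ?_, fun i x =>
    SchauderBasis.one_sub_proj_mem_tail b m (T i x), fun x hx => ?_⟩
  · refine (norm_mul_le _ _).trans (mul_le_one₀ (hb.norm_one_sub_proj_le m) (norm_nonneg _) (hT i))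
  · have hPx : P x = x := SchauderBasis.proj_eq_self_of_mem_initialSegment b hx
    -- The error of one half is absorbed into `‖x‖`, which doubles the constant.
    have h1 : ‖x - ∑ i, (c i : 𝕜) • P (S i (Q (T i x)))‖ ≤ 1 / 2 * ‖x‖ := by
      have e : (P - ∑ i, (c i : 𝕜) • z i) x = x - ∑ i, (c i : 𝕜) • P (S i (Q (T i x))) := by
        rw [sub_apply, hPx, sum_apply]
        congr 1
        refine Finset.sum_congr rfl fun i _ => ?_
        rw [← hST i]
        change (c i : 𝕜) • P (S i (Q (T i (P x)))) = _
        rw [hPx]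
      rw [← e]
      exact ContinuousLinearMap.le_of_opNorm_le _ hnear.le x
    have h2 : ‖∑ i, (c i : 𝕜) • P (S i (Q (T i x)))‖ ≤ K * ∑ i, c i * ‖Q (T i x)‖ := by
      rw [Finset.mul_sum]
      refine norm_sum_le_of_le _ fun i _ => ?_
      rw [norm_smul, RCLike.norm_ofReal, abs_of_nonneg (hc i)]
      have h3 : ‖P (S i (Q (T i x)))‖ ≤ 1 * (K * ‖Q (T i x)‖) :=
        ContinuousLinearMap.le_of_opNorm_le_of_le _ (hb.norm_proj_le n)
          (ContinuousLinearMap.le_of_opNorm_le _ (hS i) _)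
      have h4 := mul_le_mul_of_nonneg_left h3 (hc i)
      linarith
    have h5 := norm_le_norm_add_norm_sub (∑ i, (c i : 𝕜) • P (S i (Q (T i x)))) x
    rw [norm_sub_rev] at h5
    change ‖x‖ ≤ 2 * K * ∑ i, c i * ‖Q (T i x)‖
    linarith

end Tails

/-! ### Approximation by disjointly supported vectors -/

namespace SchauderBasis

variable {𝕜 : Type*} {X : Type*} [RCLike 𝕜] [NormedAddCommGroup X] [NormedSpace 𝕜 X]
  {b : SchauderBasis 𝕜 X}

lemma IsOneUnconditional.norm_sum_norm_smul_le (hb : IsOneUnconditional b) (s : Finset ℕ)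
    (a : ℕ → 𝕜) : ‖∑ i ∈ s, (‖a i‖ : 𝕜) • b i‖ ≤ 2 * ‖∑ i ∈ s, a i • b i‖ := by
  have h := hb.norm_sum_mul_le s a (fun i => (starRingEnd 𝕜) (a i) / ‖a i‖) one_pos
    fun i _ => by
      rw [norm_div, RCLike.norm_conj, RCLike.norm_ofReal, abs_norm]
      exact div_self_le_one _
  rw [mul_one] at h
  refine le_of_eq_of_le ?_ h
  congr 1
  refine Finset.sum_congr rfl fun i _ => ?_
  congr 1
  by_cases h0 : a i = 0
  · simp [h0]
  · have hn : (‖a i‖ : 𝕜) ≠ 0 := by simpa using h0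
    rw [div_mul_eq_mul_div, RCLike.conj_mul, eq_div_iff hn, sq]

/-- Finitely many bounded vectors in a tail can be approximated by combinations of a bounded
number of disjointly supported non-zero vectors in the same tail. -/
theorem IsOneUnconditional.exists_disjoint_approximation (hb : IsOneUnconditional b) (n : ℕ)
    {R ε : ℝ} (hR : 0 ≤ R) (hε : 0 < ε) :
    ∃ N : ℕ, ∀ (m : ℕ) (f : Fin n → X), (∀ j, f j ∈ tail b m) → (∀ j, ‖f j‖ ≤ R) →
      ∃ N' ≤ N, ∃ y : Fin N' → X, (∀ k, y k ∈ tail b m) ∧ (∀ k, y k ≠ 0) ∧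
        (∀ k l, k ≠ l → Disjoint (supp b (y k)) (supp b (y l))) ∧
        ∃ g : Fin n → X, (∀ j, g j ∈ Submodule.span 𝕜 (Set.range y)) ∧
          ∀ j, ‖f j - g j‖ ≤ ε := by
  classical
  -- Half of `ε` pays for truncation. The quantization error is at most `2 * η * (2 * (n * R))`: one
  -- factor 2 comes from scalar multipliers, the other from passing to moduli.
  set η : ℝ := ε / (8 * (n * R + 1)) with hη
  have hηpos : 0 < η := by positivity
  obtain ⟨t, -, htfin, ht⟩ := (isCompact_closedBall (0 : 𝕜) 1).finite_cover_balls hηpos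
  have hq : ∀ z : 𝕜, ∃ v : t, ‖z‖ ≤ 1 → ‖z - v‖ ≤ η := by
    intro z
    by_cases hz : ‖z‖ ≤ 1
    · obtain ⟨v, hv, hzv⟩ := Set.mem_iUnion₂.mp (ht (mem_closedBall_zero_iff.mpr hz))
      exact ⟨⟨v, hv⟩, fun _ => (mem_ball_iff_norm.mp hzv).le⟩
    · obtain ⟨v, hv, -⟩ := Set.mem_iUnion₂.mp (ht (Metric.mem_closedBall_self zero_le_one))
      exact ⟨⟨v, hv⟩, fun h => (hz h).elim⟩
  choose q hq using hq
  have : Fintype t := htfin.fintype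
  refine ⟨Fintype.card (Fin n → t), fun m f hfm hfR => ?_⟩
  obtain ⟨M, hM⟩ : ∃ M, ∀ j, ‖f j - b.proj M (f j)‖ ≤ ε / 2 := by
    have h : ∀ j, ∀ᶠ M in atTop, ‖f j - b.proj M (f j)‖ ≤ ε / 2 := by
      intro j
      have h1 := ((tendsto_const_nhds (x := f j)).sub (tendsto_proj b (f j))).norm
      rw [sub_self, norm_zero] at h1
      exact h1.eventually_le_const (half_pos hε)
    exact (eventually_all.mpr h).exists
  set a : Fin n → ℕ → 𝕜 := fun j i => b.coord i (f j) with ha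
  -- The envelope `e` dominates every coefficient sequence, so the ratios `a j i / e i` lie in the
  -- unit ball and can be rounded to the finite net `t`. Where `e i = 0`, all `a j i` vanish too.
  set e : ℕ → ℝ := fun i => ∑ j, ‖a j i‖ with he
  have he0 : ∀ i, 0 ≤ e i := fun i => Finset.sum_nonneg fun j _ => norm_nonneg _
  have hae : ∀ j i, ‖a j i‖ ≤ e i := fun j i =>
    Finset.single_le_sum (f := fun j => ‖a j i‖) (fun _ _ => norm_nonneg _) (Finset.mem_univ j)
  have hE : ‖∑ i ∈ Finset.range M, (e i : 𝕜) • b i‖ ≤ 2 * (n * R) := by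
    have h1 : ∑ i ∈ Finset.range M, (e i : 𝕜) • b i =
        ∑ j, ∑ i ∈ Finset.range M, (‖a j i‖ : 𝕜) • b i := by
      rw [Finset.sum_comm]
      refine Finset.sum_congr rfl fun i _ => ?_
      rw [he, RCLike.ofReal_sum, Finset.sum_smul]
    rw [h1]
    refine (norm_sum_le _ _).trans ?_
    have h2 : ∀ j ∈ (Finset.univ : Finset (Fin n)),
        ‖∑ i ∈ Finset.range M, (‖a j i‖ : 𝕜) • b i‖ ≤ 2 * R := by
      intro j _
      refine (hb.norm_sum_norm_smul_le _ (a j)).trans ?_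
      have h3 : ‖b.proj M (f j)‖ ≤ 1 * R :=
        ContinuousLinearMap.le_of_opNorm_le_of_le _ (hb.norm_proj_le M) (hfR j)
      rw [proj_apply] at h3
      linarith
    refine (Finset.sum_le_card_nsmul _ _ _ h2).trans (le_of_eq ?_)
    simp only [Finset.card_univ, Fintype.card_fin, nsmul_eq_mul]
    ring
  set lab : ℕ → Fin n → t := fun i j => q (a j i / e i) with hlab
  have hlab' : ∀ i j, ‖a j i / e i - lab i j‖ ≤ η := by
    intro i j
    refine hq _ ?_
    rw [norm_div, RCLike.norm_ofReal, abs_of_nonneg (he0 i)]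
    exact div_le_one_of_le₀ (hae j i) (he0 i)
  -- Indices with the same tuple of rounded ratios form one block. On it each `f j` is nearly a
  -- fixed multiple of the envelope, and the number of blocks depends neither on `m` nor on `f`.
  set w : (Fin n → t) → X := fun c =>
    ∑ i ∈ Finset.range M, (if lab i = c then (e i : 𝕜) else 0) • b i with hw
  have hwcoord : ∀ c i, b.coord i (w c) =
      if i ∈ Finset.range M then (if lab i = c then (e i : 𝕜) else 0) else 0 := fun c i =>
    coord_sum b _ _ i
  have hwsum : ∀ j, ∑ c, ((c j : t) : 𝕜) • w c =
      ∑ i ∈ Finset.range M, ((lab i j : 𝕜) * e i) • b i := by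
    intro j
    simp only [hw, Finset.smul_sum, smul_smul]
    rw [Finset.sum_comm]
    refine Finset.sum_congr rfl fun i _ => ?_
    rw [Finset.sum_eq_single (lab i)]
    · rw [if_pos rfl]
    · intro c _ hc
      rw [if_neg hc.symm, mul_zero, zero_smul]
    · exact fun h => (h (Finset.mem_univ _)).elim
  -- Zero blocks are discarded, which is why only an upper bound on the number of blocks is
  -- available.
  let σ := Fintype.equivFin {c // w c ≠ 0}
  refine ⟨Fintype.card {c // w c ≠ 0}, Fintype.card_subtype_le _, fun k => w (σ.symm k),
    fun k => ?_, fun k => (σ.symm k).2, fun k l hkl => ?_, fun j => ∑ c, ((c j : t) : 𝕜) • w c,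
    fun j => ?_, fun j => ?_⟩
  · rw [mem_tail_iff]
    intro i hi
    have hei : e i = 0 := Finset.sum_eq_zero fun j _ => by
      rw [ha, norm_eq_zero]
      exact (mem_tail_iff b m _).mp (hfm j) i hi
    rw [hwcoord]
    simp [hei]
  · have hsupp : ∀ c i, i ∈ supp b (w c) → lab i = c := by
      intro c i hi
      by_contra hc
      refine hi ?_
      rw [hwcoord]
      simp [hc]
    refine Set.disjoint_left.mpr fun i hi hi' => hkl ?_
    exact σ.symm.injective (Subtype.ext ((hsupp _ i hi).symm.trans (hsupp _ i hi')))
  · refine Submodule.sum_mem _ fun c _ => Submodule.smul_mem _ _ ?_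
    by_cases hc : w c = 0
    · rw [hc]
      exact Submodule.zero_mem _
    · exact Submodule.subset_span ⟨σ ⟨c, hc⟩, by simp⟩
  · have h1 : b.proj M (f j) - ∑ c, ((c j : t) : 𝕜) • w c =
        ∑ i ∈ Finset.range M, ((a j i / e i - lab i j) * e i) • b i := by
      rw [hwsum, proj_apply, ← Finset.sum_sub_distrib]
      refine Finset.sum_congr rfl fun i _ => ?_
      rw [← sub_smul, sub_mul]
      congr 2
      by_cases h0 : e i = 0
      · have : a j i = 0 := norm_le_zero_iff.mp (h0 ▸ hae j i)
        rw [h0, RCLike.ofReal_zero, mul_zero]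
        exact this
      · rw [div_mul_cancel₀ _ (by exact_mod_cast h0)]
    have h2 := hb.norm_sum_mul_le (Finset.range M) (fun i => (e i : 𝕜))
      (fun i => a j i / e i - lab i j) hηpos fun i _ => hlab' i j
    rw [← h1] at h2
    have h3 : 2 * η * (2 * (n * R)) ≤ ε / 2 := by
      rw [hη]
      have : 0 < (n : ℝ) * R + 1 := by positivity
      rw [show 2 * (ε / (8 * (n * R + 1))) * (2 * (n * R)) =
        ε / 2 * ((n * R) / (n * R + 1)) by field_simp; ring]
      refine mul_le_of_le_one_right (by positivity) ?_
      rw [div_le_one this]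
      linarith
    have h4 := mul_le_mul_of_nonneg_left hE (show (0 : ℝ) ≤ 2 * η by positivity)
    have h5 := norm_sub_le_norm_sub_add_norm_sub (f j) (b.proj M (f j))
      (∑ c, ((c j : t) : 𝕜) • w c)
    have h6 := hM j
    linarith

end SchauderBasis

/-! ### Embeddings into `ℓ_p` -/

section EllP

variable {𝕜 : Type*} [RCLike 𝕜] {p : ℝ≥0∞} [hp : Fact (1 ≤ p)]

lemma exists_embedding_of_distToSubspacesEllP_lt {F : Type*} [NormedAddCommGroup F]
    [NormedSpace 𝕜 F] {C : ℝ} (h : distToSubspacesEllP 𝕜 p F < ENNReal.ofReal C) :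
    ∃ J : F →ₗ[𝕜] lp (fun _ : ℕ => 𝕜) p, (∀ x, J x ∈ ellP 𝕜 p) ∧ (∀ x, ‖x‖ ≤ ‖J x‖) ∧
      ∀ x, ‖J x‖ ≤ C * ‖x‖ := by
  simp only [distToSubspacesEllP, banachMazurDist, iInf_lt_iff] at h
  obtain ⟨E, hE, T, hT⟩ := h
  have hT' : ‖(T : F →L[𝕜] E)‖ * ‖(T.symm : E →L[𝕜] F)‖ < C := by
    rw [← ofReal_norm, ← ofReal_norm, ← ENNReal.ofReal_mul (norm_nonneg _)] at hT
    exact (ENNReal.ofReal_lt_ofReal_iff_of_nonneg (by positivity)).mp hT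
  -- Scaling `T` by the norm of its inverse makes the lower bound exactly 1.
  set c : ℝ := ‖(T.symm : E →L[𝕜] F)‖ with hcdef
  have hc : 0 ≤ c := by rw [hcdef]; positivity
  have hnorm : ∀ x, ‖(c : 𝕜) • (T x : lp (fun _ : ℕ => 𝕜) p)‖ = c * ‖T x‖ := by
    intro x
    rw [norm_smul, RCLike.norm_ofReal, abs_of_nonneg hc]
    rfl
  refine ⟨(c : 𝕜) • (E.subtype ∘ₗ (T : F →ₗ[𝕜] E)), fun x => ?_, fun x => ?_, fun x => ?_⟩
  · exact Submodule.smul_mem _ _ (hE (T x).2)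
  · change ‖x‖ ≤ ‖(c : 𝕜) • (T x : lp (fun _ : ℕ => 𝕜) p)‖
    rw [hnorm]
    have h1 := (T.symm : E →L[𝕜] F).le_opNorm (T x)
    simpa using h1
  · change ‖(c : 𝕜) • (T x : lp (fun _ : ℕ => 𝕜) p)‖ ≤ _
    rw [hnorm]
    have h1 := (T : F →L[𝕜] E).le_opNorm x
    calc c * ‖T x‖ ≤ c * (‖(T : F →L[𝕜] E)‖ * ‖x‖) :=
          mul_le_mul_of_nonneg_left h1 hc
      _ = ‖(T : F →L[𝕜] E)‖ * c * ‖x‖ := by ring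
      _ ≤ C * ‖x‖ := by gcongr

lemma distToSubspacesEllP_le_of_embedding {F : Type*} [NormedAddCommGroup F]
    [NormedSpace 𝕜 F] {C : ℝ} (hC : 0 ≤ C) (J : F →ₗ[𝕜] lp (fun _ : ℕ => 𝕜) p)
    (hJ : ∀ x, J x ∈ ellP 𝕜 p) (h1 : ∀ x, ‖x‖ ≤ ‖J x‖) (h2 : ∀ x, ‖J x‖ ≤ C * ‖x‖) :
    distToSubspacesEllP 𝕜 p F ≤ ENNReal.ofReal C := by
  have hinj : Function.Injective J := by
    refine (injective_iff_map_eq_zero J).mpr fun x hx => ?_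
    have := h1 x
    rw [hx, norm_zero] at this
    exact norm_le_zero_iff.mp this
  let T : F ≃L[𝕜] LinearMap.range J := ContinuousLinearEquiv.mk (LinearEquiv.ofInjective J hinj)
    (AddMonoidHomClass.continuous_of_bound (LinearEquiv.ofInjective J hinj) C h2)
    (AddMonoidHomClass.continuous_of_bound (LinearEquiv.ofInjective J hinj).symm 1 fun y => by
      obtain ⟨x, rfl⟩ := (LinearEquiv.ofInjective J hinj).surjective y
      rw [LinearEquiv.symm_apply_apply, one_mul]
      exact h1 x)
  have hT1 : ‖(T : F →L[𝕜] LinearMap.range J)‖ ≤ C :=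
    ContinuousLinearMap.opNorm_le_bound _ hC h2
  have hT2 : ‖(T.symm : LinearMap.range J →L[𝕜] F)‖ ≤ 1 := by
    refine ContinuousLinearMap.opNorm_le_bound _ zero_le_one fun y => ?_
    obtain ⟨x, rfl⟩ := T.surjective y
    change ‖T.symm (T x)‖ ≤ _
    rw [ContinuousLinearEquiv.symm_apply_apply, one_mul]
    exact h1 x
  refine (iInf₂_le (LinearMap.range J) ?_).trans ((iInf_le _ T).trans ?_)
  · rintro _ ⟨x, rfl⟩
    exact hJ x
  · rw [← ofReal_norm, ← ofReal_norm, ← ENNReal.ofReal_mul (norm_nonneg _)]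
    refine ENNReal.ofReal_le_ofReal ?_
    calc _ ≤ C * 1 := mul_le_mul hT1 hT2 (by positivity) hC
      _ = C := mul_one C

/-! ### Finite weighted `ℓ_p`-sums of sequence spaces. -/

section Interleave

variable {ι : Type*} (σ : ℕ ≃ ℕ × ι) (w : ι → ℝ)

/-- Interleave finitely many weighted sequences into one. -/
def interleave (u : ι → ℕ → 𝕜) (k : ℕ) : 𝕜 := (w (σ k).2 : 𝕜) * u (σ k).2 (σ k).1

lemma norm_interleave (hw : ∀ i, 0 ≤ w i) (u : ι → ℕ → 𝕜) (k : ℕ) :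
    ‖interleave σ w u k‖ = w (σ k).2 * ‖u (σ k).2 (σ k).1‖ := by
  rw [interleave, norm_mul, RCLike.norm_ofReal, abs_of_nonneg (hw _)]

lemma tendsto_interleave [Finite ι] (u : ι → ℕ → 𝕜) (hu : ∀ i, Tendsto (u i) atTop (𝓝 0)) :
    Tendsto (interleave σ w u) atTop (𝓝 0) := by
  rw [← Nat.cofinite_eq_atTop]
  suffices h : Tendsto (fun z : ℕ × ι => (w z.2 : 𝕜) * u z.2 z.1) cofinite (𝓝 0) from
    h.comp σ.injective.tendsto_cofinite
  have hfin : ∀ i, Tendsto (fun k => (w i : 𝕜) * u i k) cofinite (𝓝 0) := fun i => by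
    rw [Nat.cofinite_eq_atTop]
    simpa using (hu i).const_mul (w i : 𝕜)
  intro s hs
  have h1 : ∀ i, {k | (w i : 𝕜) * u i k ∉ s}.Finite := fun i => hfin i hs
  refine (Set.finite_iUnion fun i => (h1 i).prod (Set.finite_singleton i)).subset ?_
  rintro ⟨k, i⟩ hz
  exact Set.mem_iUnion.mpr ⟨i, hz, rfl⟩

lemma hasSum_norm_interleave [Fintype ι] (hw : ∀ i, 0 ≤ w i) {r : ℝ} (u : ι → ℕ → 𝕜) (s : ι → ℝ)
    (hu : ∀ i, HasSum (fun k => ‖u i k‖ ^ r) (s i)) :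
    HasSum (fun k => ‖interleave σ w u k‖ ^ r) (∑ i, w i ^ r * s i) := by
  have h1 : (fun k => ‖interleave σ w u k‖ ^ r) =
      (fun z : ℕ × ι => w z.2 ^ r * ‖u z.2 z.1‖ ^ r) ∘ σ := by
    funext k
    rw [norm_interleave σ w hw, Real.mul_rpow (hw _) (norm_nonneg _)]
    rfl
  rw [h1, σ.hasSum_iff]
  have h2 : HasSum (fun k => ∑ i, w i ^ r * ‖u i k‖ ^ r) (∑ i, w i ^ r * s i) :=
    hasSum_sum fun i _ => (hu i).mul_left _
  have h3 : Summable (fun z : ℕ × ι => w z.2 ^ r * ‖u z.2 z.1‖ ^ r) := by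
    rw [summable_prod_of_nonneg fun z =>
      mul_nonneg (Real.rpow_nonneg (hw _) _) (Real.rpow_nonneg (norm_nonneg _) _)]
    refine ⟨fun k => (hasSum_fintype _).summable, ?_⟩
    simp only [tsum_fintype]
    exact h2.summable
  have h4 := h3.hasSum.prod_fiberwise fun k => hasSum_fintype _
  rw [← h4.unique h2]
  exact h3.hasSum

end Interleave

/-- A convex combination of embeddings into `ℓ_p` is dominated by a single map into `ℓ_p`. -/
theorem exists_lp_map_of_convex_combination {V : Type*} [NormedAddCommGroup V] [NormedSpace 𝕜 V]
    {ι : Type} [Fintype ι] (c : ι → ℝ) (hc : ∀ i, 0 ≤ c i) (hc1 : ∑ i, c i = 1)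
    (L : ι → V →ₗ[𝕜] lp (fun _ : ℕ => 𝕜) p) (hL : ∀ i x, L i x ∈ ellP 𝕜 p) {B : ℝ} (hB : 0 ≤ B)
    (hLB : ∀ i x, ‖L i x‖ ≤ B * ‖x‖) :
    ∃ J : V →ₗ[𝕜] lp (fun _ : ℕ => 𝕜) p, (∀ x, J x ∈ ellP 𝕜 p) ∧
      (∀ x, ∑ i, c i * ‖L i x‖ ≤ ‖J x‖) ∧ ∀ x, ‖J x‖ ≤ B * ‖x‖ := by
  have : Nonempty ι := by
    by_contra h
    rw [not_nonempty_iff] at h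
    simp at hc1
  obtain ⟨σ⟩ : Nonempty (ℕ ≃ ℕ × ι) := nonempty_equiv_of_countable
  -- With these weights the `p`-th power of the norm is `∑ c i * ‖L i x‖ ^ p`, ready for Jensen.
  set w : ι → ℝ := fun i => c i ^ (1 / p.toReal) with hw
  have hw0 : ∀ i, 0 ≤ w i := fun i => Real.rpow_nonneg (hc i) _
  set u : V → ι → ℕ → 𝕜 := fun x i => L i x with hu
  have hlin : ∀ (hmem : ∀ x, Memℓp (interleave σ w (u x)) p),
      ∃ J : V →ₗ[𝕜] lp (fun _ : ℕ => 𝕜) p, ∀ x k, J x k = interleave σ w (u x) k := by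
    intro hmem
    refine ⟨{
      toFun := fun x => ⟨interleave σ w (u x), hmem x⟩
      map_add' := ?_
      map_smul' := ?_ }, fun x k => rfl⟩
    · intro x y
      ext k
      change (w (σ k).2 : 𝕜) * (L (σ k).2 (x + y)) (σ k).1 =
        (w (σ k).2 : 𝕜) * (L (σ k).2 x) (σ k).1 + (w (σ k).2 : 𝕜) * (L (σ k).2 y) (σ k).1
      rw [map_add, ← mul_add]
      rfl
    · intro a x
      ext k
      change (w (σ k).2 : 𝕜) * (L (σ k).2 (a • x)) (σ k).1 =
        a * ((w (σ k).2 : 𝕜) * (L (σ k).2 x) (σ k).1)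
      rw [map_smul, mul_left_comm]
      rfl
  rcases eq_or_ne p ∞ with rfl | hptop
  · have hw1 : ∀ i, w i = 1 := fun i => by simp [hw]
    have hle : ∀ x k, ‖interleave σ w (u x) k‖ ≤ B * ‖x‖ := by
      intro x k
      rw [norm_interleave σ w hw0, hw1, one_mul]
      exact (lp.norm_apply_le_norm ENNReal.top_ne_zero _ _).trans (hLB _ _)
    obtain ⟨J, hJ⟩ := hlin fun x => memℓp_infty ⟨B * ‖x‖, by rintro _ ⟨k, rfl⟩; exact hle x k⟩
    refine ⟨J, fun x _ => ?_, fun x => ?_, fun x => ?_⟩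
    · simp only [hJ]
      exact tendsto_interleave σ w (u x) fun i => hL i x rfl
    · have h1 : ∀ i, ‖L i x‖ ≤ ‖J x‖ := by
        intro i
        refine lp.norm_le_of_forall_le (norm_nonneg _) fun l => ?_
        have h2 := lp.norm_apply_le_norm ENNReal.top_ne_zero (J x) (σ.symm (l, i))
        rw [hJ, norm_interleave σ w hw0, hw1, one_mul, Equiv.apply_symm_apply] at h2
        exact h2
      calc ∑ i, c i * ‖L i x‖ ≤ ∑ i, c i * ‖J x‖ :=
            Finset.sum_le_sum fun i _ => mul_le_mul_of_nonneg_left (h1 i) (hc i)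
        _ = ‖J x‖ := by rw [← Finset.sum_mul, hc1, one_mul]
    · exact lp.norm_le_of_forall_le (by positivity) fun k => hJ x k ▸ hle x k
  · have hp1 : 1 ≤ p.toReal := by
      rw [← ENNReal.toReal_one]
      exact (ENNReal.toReal_le_toReal ENNReal.one_ne_top hptop).mpr hp.out
    have hp0 : 0 < p.toReal := zero_lt_one.trans_le hp1
    have hwp : ∀ i, w i ^ p.toReal = c i := fun i => by
      rw [hw, ← Real.rpow_mul (hc i), one_div_mul_cancel hp0.ne', Real.rpow_one]
    have hsum : ∀ x, HasSum (fun k => ‖interleave σ w (u x) k‖ ^ p.toReal)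
        (∑ i, c i * ‖L i x‖ ^ p.toReal) := by
      intro x
      have h := hasSum_norm_interleave σ w hw0 (u x) (fun i => ‖L i x‖ ^ p.toReal)
        fun i => lp.hasSum_norm hp0 (L i x)
      simpa only [hwp] using h
    obtain ⟨J, hJ⟩ := hlin fun x => memℓp_gen (hsum x).summable
    have hJnorm : ∀ x, ‖J x‖ ^ p.toReal = ∑ i, c i * ‖L i x‖ ^ p.toReal := by
      intro x
      refine (lp.hasSum_norm hp0 (J x)).unique ?_
      simpa only [hJ] using hsum x
    refine ⟨J, fun x h => (hptop h).elim, fun x => ?_, fun x => ?_⟩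
    · rw [← Real.rpow_le_rpow_iff (Finset.sum_nonneg fun i _ =>
        mul_nonneg (hc i) (norm_nonneg _)) (norm_nonneg _) hp0, hJnorm]
      exact Real.rpow_arith_mean_le_arith_mean_rpow _ _ _ (fun i _ => hc i) hc1
        (fun i _ => norm_nonneg _) hp1
    · rw [← Real.rpow_le_rpow_iff (norm_nonneg _) (by positivity) hp0, hJnorm]
      calc ∑ i, c i * ‖L i x‖ ^ p.toReal ≤ ∑ i, c i * (B * ‖x‖) ^ p.toReal := by
            refine Finset.sum_le_sum fun i _ => mul_le_mul_of_nonneg_left ?_ (hc i)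
            exact Real.rpow_le_rpow (norm_nonneg _) (hLB i x) hp0.le
        _ = (B * ‖x‖) ^ p.toReal := by rw [← Finset.sum_mul, hc1, one_mul]

end EllP

/-! ### The main theorem -/

section InitialSegments

variable {𝕜 : Type v} {X : Type u} [RCLike 𝕜] [NormedAddCommGroup X] [NormedSpace 𝕜 X]

/-- Bounded operators mapping into far tails are, on an initial segment and up to a small error,
well approximated by maps into `ℓ_p`, when disjoint vectors far out span subspaces of `ℓ_p`. -/
lemma exists_tail_forall_exists_lp_map {b : SchauderBasis 𝕜 X}
    (hb : SchauderBasis.IsOneUnconditional b) {C : ℝ} {p : ℝ≥0∞} [Fact (1 ≤ p)]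
    (h_i : ∀ n : ℕ, ∃ m : ℕ, ∀ y : Fin n → X,
      (∀ j, y j ∈ SchauderBasis.tail b m) → (∀ j, y j ≠ 0) →
      (∀ j k, j ≠ k → Disjoint (SchauderBasis.supp b (y j)) (SchauderBasis.supp b (y k))) →
      distToSubspacesEllP 𝕜 p (Submodule.span 𝕜 (Set.range y)) < ENNReal.ofReal C)
    (hC : 0 ≤ C) (n : ℕ) {ε : ℝ} (hε : 0 < ε) :
    ∃ m : ℕ, ∀ T : X →L[𝕜] X, ‖T‖ ≤ 1 → (∀ x, T x ∈ SchauderBasis.tail b m) →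
      ∃ L : SchauderBasis.initialSegment b n →ₗ[𝕜] lp (fun _ : ℕ => 𝕜) p,
        (∀ x, L x ∈ ellP 𝕜 p) ∧ (∀ x : SchauderBasis.initialSegment b n, ‖T x‖ ≤ ‖L x‖ + ε * ‖x‖) ∧
        ∀ x, ‖L x‖ ≤ C * (1 + ε) * ‖x‖ := by
  set A : ℝ := ∑ j : Fin n, ‖b.coord j‖ with hA
  set R : ℝ := ∑ j : Fin n, ‖b j‖ with hR
  have hA0 : 0 ≤ A := Finset.sum_nonneg fun _ _ => norm_nonneg _
  obtain ⟨N, hN⟩ := hb.exists_disjoint_approximation n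
    (Finset.sum_nonneg fun (j : Fin n) _ => norm_nonneg (b j) : 0 ≤ R)
    (show 0 < ε / (A + 1) by positivity)
  choose m hm using h_i
  -- The number of blocks depends on `T` but is at most `N`, so the tail is chosen to serve every
  -- number up to `N`.
  refine ⟨(Finset.range (N + 1)).sup m, fun T hT hTtail => ?_⟩
  obtain ⟨N', hN', y, hytail, hy0, hydisj, g, hgspan, hgnorm⟩ := hN _ (fun j => T (b j))
    (fun j => hTtail _) (fun j => by
      refine (T.le_of_opNorm_le hT (b j)).trans ?_
      rw [one_mul]
      exact Finset.single_le_sum (f := fun j : Fin n => ‖b j‖) (fun _ _ => norm_nonneg _)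
        (Finset.mem_univ j))
  obtain ⟨J, hJmem, hJ1, hJ2⟩ := exists_embedding_of_distToSubspacesEllP_lt
    (hm N' y (fun k => SchauderBasis.tail_antitone b
      (Finset.le_sup (f := m) (Finset.mem_range.mpr (Nat.lt_succ_of_le hN'))) (hytail k)) hy0 hydisj)
  let G : X →ₗ[𝕜] Submodule.span 𝕜 (Set.range y) :=
    ∑ j : Fin n, (b.coord j).toLinearMap.smulRight (⟨g j, hgspan j⟩ : Submodule.span 𝕜 (Set.range y))
  have hG : ∀ x, ((G x : Submodule.span 𝕜 (Set.range y)) : X) =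
      ∑ j : Fin n, b.coord j x • g j := by
    intro x
    simp [G]
  have hclose : ∀ x : SchauderBasis.initialSegment b n, ‖T x - G x‖ ≤ ε * ‖x‖ := by
    intro x
    have hx : T x = ∑ j : Fin n, b.coord j x • T (b j) := by
      conv_lhs => rw [← SchauderBasis.proj_eq_self_of_mem_initialSegment b x.2,
        SchauderBasis.proj_apply, map_sum]
      rw [← Fin.sum_univ_eq_sum_range (fun i => T (b.coord i (x : X) • b i))]
      exact Finset.sum_congr rfl fun j _ => map_smul _ _ _
    rw [hx, hG, ← Finset.sum_sub_distrib]
    have h1 : ‖∑ j : Fin n, (b.coord j (x : X) • T (b j) - b.coord j (x : X) • g j)‖ ≤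
        ∑ j : Fin n, ‖b.coord j‖ * (‖x‖ * (ε / (A + 1))) := by
      refine norm_sum_le_of_le _ fun j _ => ?_
      rw [← smul_sub, norm_smul, ← mul_assoc]
      exact mul_le_mul ((b.coord j).le_opNorm _) (hgnorm j) (norm_nonneg _) (by positivity)
    refine h1.trans ?_
    rw [← Finset.sum_mul, ← hA, show A * (‖x‖ * (ε / (A + 1))) = A / (A + 1) * (ε * ‖x‖) by ring]
    refine mul_le_of_le_one_left (by positivity) ?_
    rw [div_le_one (by positivity)]
    linarith
  refine ⟨J ∘ₗ G ∘ₗ (SchauderBasis.initialSegment b n).subtype, fun x => hJmem _, fun x => ?_,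
    fun x => ?_⟩
  · have h1 := norm_le_norm_add_norm_sub (G x : X) (T x)
    have h2 : ‖(G x : X)‖ ≤ ‖J (G x)‖ := hJ1 _
    have h3 := hclose x
    change ‖T x‖ ≤ ‖J (G x)‖ + ε * ‖x‖
    linarith [norm_sub_rev (T x) (G x : X)]
  · have h1 := norm_le_norm_add_norm_sub (T x) (G x : X)
    have h2 : ‖J (G x)‖ ≤ C * ‖(G x : X)‖ := hJ2 _
    have h3 := hclose x
    have h4 : ‖T x‖ ≤ 1 * ‖x‖ := T.le_of_opNorm_le hT _
    change ‖J (G x)‖ ≤ _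
    refine h2.trans ?_
    rw [mul_assoc]
    refine mul_le_mul_of_nonneg_left ?_ hC
    linarith [norm_sub_rev (T x) (G x : X)]

end InitialSegments

theorem mainTheorem2 {𝕜 : Type v} {X : Type u} [RCLike 𝕜] [NormedAddCommGroup X]
    [NormedSpace 𝕜 X] [CompleteSpace X]
    (b : SchauderBasis 𝕜 X) (hb : SchauderBasis.IsOneUnconditional b)
    (δ : ℝ) (hδ : 1 ≤ δ) (p : ℝ≥0∞) [Fact (1 ≤ p)]
    (h_i : ∀ n : ℕ, ∃ m : ℕ, ∀ y : Fin n → X,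
      (∀ j, y j ∈ SchauderBasis.tail b m) → (∀ j, y j ≠ 0) →
      (∀ j k, j ≠ k → Disjoint (SchauderBasis.supp b (y j)) (SchauderBasis.supp b (y k))) →
      distToSubspacesEllP 𝕜 p (Submodule.span 𝕜 (Set.range y)) ≤ ENNReal.ofReal δ)
    (h_ii : Tendsto (fun n : ℕ => distToSubspacesEllP 𝕜 p (SchauderBasis.initialSegment b n))
      atTop (𝓝 ∞)) :
    ¬ IsAmenable 𝕜 (approximableOperators 𝕜 X) := by
  intro h
  obtain ⟨K, hK, hfac⟩ := h.exists_average_through_tail hb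
  -- Slack above `δ`, since the infimum defining the distance need not be attained.
  set C : ℝ := δ + 1 with hC
  have hC0 : 0 ≤ C := by linarith
  -- Chosen so that `K * ε = 1 / 2`: the approximation error costs half of `‖x‖`.
  set ε : ℝ := 1 / (2 * K) with hε
  have hε0 : 0 < ε := by positivity
  have hδC : ENNReal.ofReal δ < ENNReal.ofReal C :=
    (ENNReal.ofReal_lt_ofReal_iff (by linarith)).mpr (by linarith)
  have h_i' : ∀ n : ℕ, ∃ m : ℕ, ∀ y : Fin n → X,
      (∀ j, y j ∈ SchauderBasis.tail b m) → (∀ j, y j ≠ 0) →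
      (∀ j k, j ≠ k → Disjoint (SchauderBasis.supp b (y j)) (SchauderBasis.supp b (y k))) →
      distToSubspacesEllP 𝕜 p (Submodule.span 𝕜 (Set.range y)) < ENNReal.ofReal C := by
    intro n
    obtain ⟨m, hm⟩ := h_i n
    exact ⟨m, fun y h1 h2 h3 => (hm y h1 h2 h3).trans_lt hδC⟩
  have hbound : ∀ n, distToSubspacesEllP 𝕜 p (SchauderBasis.initialSegment b n) ≤
      ENNReal.ofReal (2 * K * (C * (1 + ε))) := by
    intro n
    obtain ⟨m, hm⟩ := exists_tail_forall_exists_lp_map hb h_i' hC0 n hε0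
    obtain ⟨ι, hι, c, T, hc, hc1, hT, hTtail, hTlow⟩ := hfac m n
    choose L hLmem hLlow hLup using fun i => hm (T i) (hT i) (hTtail i)
    obtain ⟨J, hJmem, hJlow, hJup⟩ := exists_lp_map_of_convex_combination c hc hc1 L hLmem
      (by positivity : 0 ≤ C * (1 + ε)) hLup
    have hnorm : ∀ x, ‖(((2 * K : ℝ) : 𝕜) • J) x‖ = 2 * K * ‖J x‖ := by
      intro x
      rw [LinearMap.smul_apply, norm_smul, RCLike.norm_ofReal, abs_of_pos (by positivity)]
    refine distToSubspacesEllP_le_of_embedding (by positivity) (((2 * K : ℝ) : 𝕜) • J)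
      (fun x => Submodule.smul_mem _ _ (hJmem x)) (fun x => ?_) fun x => ?_
    · rw [hnorm]
      have h1 : ∑ i, c i * ‖T i x‖ ≤ ‖J x‖ + ε * ‖x‖ := by
        calc ∑ i, c i * ‖T i x‖ ≤ ∑ i, (c i * ‖L i x‖ + c i * (ε * ‖x‖)) := by
              refine Finset.sum_le_sum fun i _ => ?_
              rw [← mul_add]
              exact mul_le_mul_of_nonneg_left (hLlow i x) (hc i)
          _ = ∑ i, c i * ‖L i x‖ + ε * ‖x‖ := by
              rw [Finset.sum_add_distrib, ← Finset.sum_mul, hc1, one_mul]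
          _ ≤ ‖J x‖ + ε * ‖x‖ := by linarith [hJlow x]
      have h2 : ‖x‖ ≤ K * (‖J x‖ + ε * ‖x‖) :=
        (hTlow x x.2).trans (mul_le_mul_of_nonneg_left h1 hK.le)
      have h3 : K * (ε * ‖x‖) = ‖x‖ / 2 := by
        rw [hε]
        field_simp
      rw [mul_add, h3] at h2
      linarith
    · rw [hnorm, mul_assoc (2 * K)]
      exact mul_le_mul_of_nonneg_left (hJup x) (by positivity)
  obtain ⟨n, hn⟩ := (h_ii.eventually (lt_mem_nhds
    (ENNReal.ofReal_lt_top (r := 2 * K * (C * (1 + ε)))))).exists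
  exact absurd (hbound n) (not_le.mpr hn)
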